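/- Let $\mathbb F_q$ be a finite field and let $\gamma,\kappa,z$ be non-negative integers such that $z$ is an odd prime, $1+x+\dots+x^{z-1}$ is irreducible over $\mathbb F_q$, $\gamma!<z$ and $\kappa\le q$. For $S=(s_{i,j})\in\mathbb F_q^{\gamma\times\kappa}$ and $P=(p_{i,j})$ a $\gamma\times\kappa$ matrix of integers with $0\le p_{i,j}\le z-1$, let $H(S,P)$ be the parity check matrix of the QC-LDPC code with scaling matrix $S$ and power matrix $P$, i.e. the $\gamma\times\kappa$ block matrix with blocks $s_{i,j}C^{p_{i,j}}$, where $C^{p}$ is the $z\times z$ matrix with a one in row $r$, column $(r-p)\bmod z$ for $0\le r\le z-1$ and zeros elsewhere. The girth of the code is the length of a shortest cycle ($\infty$ if there is none) of its Tanner graph, the bipartite graph on the rows and columns of $H(S,P)$ in which a row and a column are adjacent when the corresponding entry is non-zero. The code is Block-MDS if for every $\gamma$-element set of block columns the $\gamma z\times\gamma z$ submatrix of $H(S,P)$ formed by these block columns has full rank. A $\gamma\times\kappa$ matrix is MDS if each of its $\gamma\times\gamma$ submatrices (obtained by choosing $\gamma$ columns) has full rank. (If $\kappa<\gamma$, these conditions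 are empty.) Let $S_0\in\mathbb F_q^{\gamma\times\kappa}$ and $P$ be such that the QC-LDPC code given by $(S_0,P)$ has girth at least $2\gamma+2$. Then: 1. For every $S\in\mathbb F_q^{\gamma\times\kappa}$, the condition that $\gcd(f_\tau(x),x^z-1)=1$ for all $\tau(1)<\dots<\tau(\gamma)$ in $\{1,\dots,\kappa\}$, where $$f_\tau(x)=\sum_{\sigma\in S_\gamma}\operatorname{sign}(\sigma)\Big(\prod_{i=1}^{\gamma}s_{\sigma(i),\tau(i)}\Big)x^{\left(\sum_{i=1}^{\gamma}p_{\sigma(i),\tau(i)}\right)\bmod z},$$ and $S_\gamma$ is the group of permutations of $\{1,\dots,\gamma\}$, holds if and only if $S$ is MDS. 2. For every $\gamma\times\kappa$ Vandermonde matrix $S=(\alpha_j^{\,i-1})_{1\le i\le\gamma,\,1\le j\le\kappa}$ with pairwise distinct $\alpha_1,\dots,\alpha_\kappa\in\mathbb F_q$ (where $0^0=1$), $S$ is MDS and the code given by $(S,P)$ is Block-MDS; if moreover all entries of $S_0$ are non-zero, then the code given by $(S,P)$ still has girth at least $2\gamma+2$. 3. Such a Vandermonde matrix exists. Thus the code can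 be made Block-MDS by replacing its scaling matrix by a Vandermonde matrix, keeping $P$. -/

import Mathlib

namespace QCLDPC

/-- The `z × z` circulant shift matrix `C ^ p`: row `r` has a one in column `r - p` modulo `z`
(subtraction in `Fin z` is modulo `z`), and zeros elsewhere. -/
def shiftMatrix (F : Type*) [Field F] {z : ℕ} (p : Fin z) : Matrix (Fin z) (Fin z) F :=
  Matrix.of fun r c => if c = r - p then 1 else 0

/-- The parity check matrix of the (type-1) QC-LDPC code with scaling matrix `S` and power
matrix `P`: the `γ × κ` block matrix whose block `(i, j)` is `s_{i,j} C ^ p_{i,j}`.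
Row `(i, r)` is row `r` of block row `i`, column `(j, c)` is column `c` of block column `j`. -/
def parityCheck {F : Type*} [Field F] {γ κ z : ℕ}
    (S : Matrix (Fin γ) (Fin κ) F) (P : Matrix (Fin γ) (Fin κ) (Fin z)) :
    Matrix (Fin γ × Fin z) (Fin κ × Fin z) F :=
  Matrix.of fun a b => S a.1 b.1 * shiftMatrix F (P a.1 b.1) a.2 b.2

/-- The Tanner graph of a parity check matrix `H`: the bipartite graph on rows and columns in
which row `r` is joined to column `c` when `H r c ≠ 0`. -/
def tannerGraph {F m n : Type*} [Field F] (H : Matrix m n F) : SimpleGraph (m ⊕ n) :=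
  SimpleGraph.fromRel fun u v => ∃ r c, u = Sum.inl r ∧ v = Sum.inr c ∧ H r c ≠ 0

/-- The code with scaling matrix `S` and power matrix `P` is Block-MDS: for every set `B` of
`γ` block columns, the `γz × γz` submatrix of the parity check matrix formed by all the
columns in these block columns has full rank. -/
def IsBlockMDS {F : Type*} [Field F] {γ κ z : ℕ}
    (S : Matrix (Fin γ) (Fin κ) F) (P : Matrix (Fin γ) (Fin κ) (Fin z)) : Prop :=
  ∀ B : Finset (Fin κ), B.card = γ →
    ((parityCheck S P).submatrix id
      (fun b : {j // j ∈ B} × Fin z => ((b.1 : Fin κ), b.2))).rank = γ * z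

/-- A `γ × κ` matrix is MDS: every `γ × γ` submatrix has full rank. -/
def IsMDS {F : Type*} [Field F] {γ κ : ℕ} (S : Matrix (Fin γ) (Fin κ) F) : Prop :=
  ∀ B : Finset (Fin κ), B.card = γ →
    (S.submatrix id (fun b : {j // j ∈ B} => (b : Fin κ))).rank = γ

/-- The polynomial
`f_τ(x) = ∑ σ, sign(σ) (∏ i, s_{σ(i),τ(i)}) x ^ ((∑ i, p_{σ(i),τ(i)}) mod z)`,
where `τ` enumerates `γ` of the `κ` block columns increasingly. -/
noncomputable def detPoly {F : Type*} [Field F] {γ κ z : ℕ}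
    (S : Matrix (Fin γ) (Fin κ) F) (P : Matrix (Fin γ) (Fin κ) (Fin z))
    (τ : Fin γ ↪o Fin κ) : Polynomial F :=
  ∑ σ : Equiv.Perm (Fin γ),
    Polynomial.monomial ((∑ i, (P (σ i) (τ i) : ℕ)) % z)
      (((Equiv.Perm.sign σ : ℤ) : F) * ∏ i, S (σ i) (τ i))

/-- The gcd condition: `gcd(f_τ(x), x ^ z - 1) = 1` for all `γ`-subsets `τ` of the block
columns. -/
def GcdCondition {F : Type*} [Field F] {γ κ z : ℕ}
    (S : Matrix (Fin γ) (Fin κ) F) (P : Matrix (Fin γ) (Fin κ) (Fin z)) : Prop :=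
  ∀ τ : Fin γ ↪o Fin κ, IsCoprime (detPoly S P τ) (Polynomial.X ^ z - 1)

/-- `S` is a `γ × κ` Vandermonde matrix: `s_{i,j} = α_j ^ i` for `0 ≤ i < γ`, with pairwise
distinct nodes `α_j`. -/
def IsVandermonde {F : Type*} [Field F] {γ κ : ℕ} (S : Matrix (Fin γ) (Fin κ) F) : Prop :=
  ∃ α : Fin κ → F, Function.Injective α ∧ S = Matrix.of fun (i : Fin γ) j => α j ^ (i : ℕ)

end QCLDPC

/-!
Write `Φ = 1 + X + ⋯ + X ^ (z - 1)`, so that `X ^ z - 1 = Φ * (X - 1)` with `Φ` irreducible.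

*The gcd condition.* `detPoly S P τ` is the reduction modulo `X ^ z - 1` of the determinant of the
matrix `(s_{i,τ(j)} X ^ p_{i,τ(j)})`. Its value at `1` is therefore the minor of `S` on the columns
`τ`, so it is coprime to `X - 1` exactly when that minor is non-zero. It has degree below `z` and at
most `γ! < z` terms, while the only multiples of `Φ` of degree below `z` are the scalar multiples
of `Φ`, whose `z` coefficients below degree `z` are all equal. Hence it is either
zero or coprime to `Φ`, and a non-zero minor excludes the former. This gives `gcdCondition_iff_isMDS`, for every power matrix.

*Block-MDS.* Substituting the shift matrix `C`, which satisfies `C ^ z = 1`, for `X` turns the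
polynomial matrix into the block matrix of the code. A Bézout relation between its determinant and
`X ^ z - 1` becomes an inverse of the determinant's value at `C`, and the adjugate then yields an
inverse of the block matrix (`isBlockMDS_of_gcdCondition`).

Vandermonde matrices are MDS by the Vandermonde determinant. The girth is preserved because the
Tanner graph depends only on the support of the scaling matrix, and shrinking the support only
removes edges.
-/

namespace QCLDPC

open Polynomial Matrix

/-! ### Square submatrices and rank -/

theorem rank_eq_card_iff_det_ne_zero {F : Type*} [Field F] {n : ℕ}
    (A : Matrix (Fin n) (Fin n) F) : A.rank = n ↔ A.det ≠ 0 := by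
  constructor
  · intro h
    have hc : LinearIndependent F A.col := by
      rw [linearIndependent_iff_card_eq_finrank_span, Set.finrank, ← rank_eq_finrank_span_cols, h,
        Fintype.card_fin]
    exact ((isUnit_iff_isUnit_det A).1 (linearIndependent_cols_iff_isUnit.1 hc)).ne_zero
  · intro h
    simpa using rank_of_isUnit A ((isUnit_iff_isUnit_det A).2 h.isUnit)

/-- `IsMDS` in terms of the minors on increasingly enumerated columns. -/
theorem isMDS_iff_det_ne_zero {F : Type*} [Field F] {γ κ : ℕ} (S : Matrix (Fin γ) (Fin κ) F) :
    IsMDS S ↔ ∀ τ : Fin γ ↪o Fin κ, (S.submatrix id τ).det ≠ 0 := by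
  have key : ∀ (B : Finset (Fin κ)) (hB : B.card = γ),
      (S.submatrix id (fun b : {j // j ∈ B} => (b : Fin κ))).rank =
        (S.submatrix id (B.orderEmbOfFin hB)).rank := fun B hB =>
    (rank_submatrix _ (Equiv.refl _) (B.orderIsoOfFin hB).toEquiv).symm
  constructor
  · intro h τ
    have hB : (Finset.univ.map τ.toEmbedding).card = γ := by simp
    have hτ : τ = (Finset.univ.map τ.toEmbedding).orderEmbOfFin hB :=
      Finset.orderEmbOfFin_unique' hB fun x => by simp
    rw [hτ, ← rank_eq_card_iff_det_ne_zero, ← key, h _ hB]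
  · intro h B hB
    rw [key B hB, rank_eq_card_iff_det_ne_zero]
    exact h _

theorem IsVandermonde.isMDS {F : Type*} [Field F] {γ κ : ℕ} {S : Matrix (Fin γ) (Fin κ) F}
    (hS : IsVandermonde S) : IsMDS S := by
  obtain ⟨α, hα, rfl⟩ := hS
  refine (isMDS_iff_det_ne_zero _).2 fun τ => ?_
  have : (Matrix.of fun (i : Fin γ) j => α j ^ (i : ℕ)).submatrix id τ =
      (vandermonde (α ∘ τ))ᵀ := by
    ext i j
    simp [vandermonde_apply]
  rw [this, det_transpose, det_vandermonde_ne_zero_iff]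
  exact hα.comp τ.injective

/-! ### The gcd condition -/

/-- The polynomial matrix `(s_{i,τ(j)} X ^ p_{i,τ(j)})`, whose value at the circulant `C` is the
block submatrix of the parity check matrix on the block columns `τ`. -/
noncomputable def polyMatrix {F : Type*} [Field F] {γ κ z : ℕ}
    (S : Matrix (Fin γ) (Fin κ) F) (P : Matrix (Fin γ) (Fin κ) (Fin z))
    (τ : Fin γ ↪o Fin κ) : Matrix (Fin γ) (Fin γ) F[X] :=
  Matrix.of fun i j => monomial (P i (τ j) : ℕ) (S i (τ j))

/-- `detPoly S P τ` and `det (polyMatrix S P τ)` agree modulo `X ^ z - 1`. -/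
theorem aeval_detPoly {F A : Type*} [Field F] [Ring A] [Algebra F A] {γ κ z : ℕ}
    (S : Matrix (Fin γ) (Fin κ) F) (P : Matrix (Fin γ) (Fin κ) (Fin z)) (τ : Fin γ ↪o Fin κ)
    {x : A} (hx : x ^ z = 1) : aeval x (detPoly S P τ) = aeval x (polyMatrix S P τ).det := by
  have hprod : ∀ σ : Equiv.Perm (Fin γ), ∏ i, polyMatrix S P τ (σ i) i =
      monomial (∑ i, (P (σ i) (τ i) : ℕ)) (∏ i, S (σ i) (τ i)) := fun σ => by
    simp only [polyMatrix, of_apply, ← C_mul_X_pow_eq_monomial, Finset.prod_mul_distrib,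
      Finset.prod_pow_eq_pow_sum, map_prod]
  simp only [detPoly, det_apply', hprod, map_sum, map_mul, aeval_monomial, map_intCast,
    ← pow_eq_pow_mod _ hx, mul_assoc]

theorem eval_one_detPoly {F : Type*} [Field F] {γ κ z : ℕ}
    (S : Matrix (Fin γ) (Fin κ) F) (P : Matrix (Fin γ) (Fin κ) (Fin z)) (τ : Fin γ ↪o Fin κ) :
    (detPoly S P τ).eval 1 = (S.submatrix id τ).det := by
  rw [← coe_aeval_eq_eval, aeval_detPoly S P τ (one_pow z), AlgHom.map_det]
  congr 1
  ext i j
  simp [polyMatrix]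

theorem card_support_detPoly_le {F : Type*} [Field F] {γ κ z : ℕ}
    (S : Matrix (Fin γ) (Fin κ) F) (P : Matrix (Fin γ) (Fin κ) (Fin z)) (τ : Fin γ ↪o Fin κ) :
    (detPoly S P τ).support.card ≤ γ.factorial := by
  classical
  have hsub : (detPoly S P τ).support ⊆ Finset.univ.image
      fun σ : Equiv.Perm (Fin γ) => (∑ i, (P (σ i) (τ i) : ℕ)) % z := by
    intro n hn
    rw [mem_support_iff, detPoly, finsetSum_coeff] at hn
    obtain ⟨σ, -, hσ⟩ := Finset.exists_ne_zero_of_sum_ne_zero hn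
    rw [coeff_monomial] at hσ
    exact Finset.mem_image.2 ⟨σ, Finset.mem_univ _, by_contra fun h => hσ (if_neg h)⟩
  refine (Finset.card_le_card hsub).trans (Finset.card_image_le.trans ?_)
  simp [Fintype.card_perm]

theorem degree_detPoly_lt {F : Type*} [Field F] {γ κ z : ℕ} (hz : 0 < z)
    (S : Matrix (Fin γ) (Fin κ) F) (P : Matrix (Fin γ) (Fin κ) (Fin z)) (τ : Fin γ ↪o Fin κ) :
    (detPoly S P τ).degree < z := by
  refine (degree_sum_le _ _).trans_lt ((Finset.sup_lt_iff (WithBot.bot_lt_coe z)).2 fun σ _ => ?_)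
  exact (degree_monomial_le _ _).trans_lt (Nat.cast_lt.2 (Nat.mod_lt _ hz))

/-- A non-zero polynomial of degree below `z` that is divisible by `1 + X + ⋯ + X ^ (z - 1)` is a
scalar multiple of it, so it has `z` terms. -/
theorem le_card_support_of_geom_sum_dvd {F : Type*} [Field F] {z : ℕ} (hz : 0 < z) {f : F[X]}
    (hf : f ≠ 0) (hdeg : f.degree < z) (hdvd : (∑ i ∈ Finset.range z, (X : F[X]) ^ i) ∣ f) :
    z ≤ f.support.card := by
  obtain ⟨g, rfl⟩ := hdvd
  have hg : g ≠ 0 := right_ne_zero_of_mul hf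
  have hcoeff : ∀ n < z, (∑ i ∈ Finset.range z, (X : F[X]) ^ i).coeff n = 1 := fun n hn => by
    simp [finsetSum_coeff, coeff_X_pow, hn]
  have hΦ : ((z - 1 : ℕ) : WithBot ℕ) ≤ (∑ i ∈ Finset.range z, (X : F[X]) ^ i).degree :=
    le_degree_of_ne_zero (by rw [hcoeff _ (by omega)]; exact one_ne_zero)
  have hg0 : g.natDegree = 0 := by
    rw [degree_mul, degree_eq_natDegree hg] at hdeg
    have h1 : ((z - 1 + g.natDegree : ℕ) : WithBot ℕ) < z := by
      push_cast
      exact (add_le_add_left hΦ _).trans_lt hdeg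
    have := Nat.cast_lt.1 h1
    omega
  rw [eq_C_of_natDegree_eq_zero hg0] at hg ⊢
  calc z = (Finset.range z).card := (Finset.card_range z).symm
    _ ≤ _ := Finset.card_le_card fun n hn => by
      rw [mem_support_iff, coeff_mul_C, hcoeff n (Finset.mem_range.1 hn), one_mul]
      exact fun h => hg (by rw [h, C_0])

theorem isCoprime_detPoly_iff {F : Type*} [Field F] {γ κ z : ℕ} (hz : 0 < z)
    (hirr : Irreducible (∑ i ∈ Finset.range z, (X : F[X]) ^ i)) (hγ : γ.factorial < z)
    (S : Matrix (Fin γ) (Fin κ) F) (P : Matrix (Fin γ) (Fin κ) (Fin z)) (τ : Fin γ ↪o Fin κ) :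
    IsCoprime (detPoly S P τ) (X ^ z - 1) ↔ (S.submatrix id τ).det ≠ 0 := by
  have hX : IsCoprime (detPoly S P τ) (X - 1) ↔ (S.submatrix id τ).det ≠ 0 := by
    rw [isCoprime_comm, ← C_1, (irreducible_X_sub_C (1 : F)).coprime_iff_not_dvd,
      dvd_iff_isRoot, IsRoot.def, eval_one_detPoly]
  rw [← geom_sum_mul, IsCoprime.mul_right_iff, hX, and_iff_right_iff_imp]
  intro hdet
  rw [isCoprime_comm, hirr.coprime_iff_not_dvd]
  intro hdvd
  have hne : detPoly S P τ ≠ 0 := fun h => hdet (by rw [← eval_one_detPoly S P, h, eval_zero])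
  have h1 := le_card_support_of_geom_sum_dvd hz hne (degree_detPoly_lt hz S P τ) hdvd
  have h2 := card_support_detPoly_le S P τ
  omega

theorem gcdCondition_iff_isMDS {F : Type*} [Field F] {γ κ z : ℕ} (hz : 0 < z)
    (hirr : Irreducible (∑ i ∈ Finset.range z, (X : F[X]) ^ i)) (hγ : γ.factorial < z)
    (S : Matrix (Fin γ) (Fin κ) F) (P : Matrix (Fin γ) (Fin κ) (Fin z)) :
    GcdCondition S P ↔ IsMDS S := by
  rw [isMDS_iff_det_ne_zero]
  exact forall_congr' fun τ => isCoprime_detPoly_iff hz hirr hγ S P τ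

/-! ### Circulant blocks and the Block-MDS property -/

theorem shiftMatrix_zero (F : Type*) [Field F] {z : ℕ} [NeZero z] :
    shiftMatrix F (0 : Fin z) = 1 := by
  ext r c
  simp [shiftMatrix, one_apply, eq_comm]

theorem shiftMatrix_mul (F : Type*) [Field F] {z : ℕ} [NeZero z] (p q : Fin z) :
    shiftMatrix F p * shiftMatrix F q = shiftMatrix F (p + q) := by
  ext r c
  simp [shiftMatrix, mul_apply, eq_sub_iff_add_eq, add_assoc, add_comm q p]

theorem shiftMatrix_one_pow (F : Type*) [Field F] {z : ℕ} [NeZero z] (n : ℕ) :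
    shiftMatrix F (1 : Fin z) ^ n = shiftMatrix F (Fin.ofNat z n) := by
  induction n with
  | zero => simpa using (shiftMatrix_zero F (z := z)).symm
  | succ n ih =>
    rw [pow_succ, ih, shiftMatrix_mul]
    congr 1
    ext
    simp [Fin.val_add]

theorem isBlockMDS_of_gcdCondition {F : Type*} [Field F] {γ κ z : ℕ} [NeZero z]
    {S : Matrix (Fin γ) (Fin κ) F} {P : Matrix (Fin γ) (Fin κ) (Fin z)}
    (h : GcdCondition S P) : IsBlockMDS S P := by
  intro B hB
  set τ := B.orderEmbOfFin hB
  set c : Matrix (Fin z) (Fin z) F := shiftMatrix F 1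
  have hc : c ^ z = 1 := by
    rw [shiftMatrix_one_pow, ← shiftMatrix_zero]
    congr 1
    ext
    simp
  obtain ⟨a, b, hab⟩ := h τ
  let φ := (aeval c : F[X] →ₐ[F] Matrix (Fin z) (Fin z) F).toRingHom.mapMatrix (m := Fin γ)
  -- The Bézout coefficient `a` inverts the determinant at `c`; the adjugate does the rest.
  have hdet : aeval c ((polyMatrix S P τ).det * a) = 1 := by
    have := congrArg (aeval c) hab
    rw [map_add, map_mul, map_mul, aeval_detPoly S P τ hc] at this
    rw [mul_comm, map_mul]
    simpa [hc] using this
  have hφ : φ (polyMatrix S P τ) * φ ((polyMatrix S P τ).adjugate * a • 1) = 1 := by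
    rw [← map_mul, ← mul_assoc, mul_adjugate, smul_mul_smul_comm, one_mul, smul_one_eq_diagonal]
    change (diagonal _).map (aeval c) = 1
    rw [diagonal_map (map_zero _), ← diagonal_one]
    exact congrArg diagonal (funext fun _ => hdet)
  have hH : (parityCheck S P).submatrix id (fun b : Fin γ × Fin z => (τ b.1, b.2)) =
      comp _ _ _ _ F (φ (polyMatrix S P τ)) := by
    ext ⟨i, r⟩ ⟨j, k⟩
    have : φ (polyMatrix S P τ) i j = S i (τ j) • shiftMatrix F (P i (τ j)) := by
      change aeval c (monomial (P i (τ j) : ℕ) (S i (τ j))) = _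
      rw [aeval_monomial, shiftMatrix_one_pow, ← Algebra.smul_def, Fin.ofNat_val_eq_self]
    simp [parityCheck, this]
  have hunit : IsUnit ((parityCheck S P).submatrix id
      (fun b : Fin γ × Fin z => (τ b.1, b.2))) := by
    rw [hH]
    refine IsUnit.of_mul_eq_one
      (comp _ _ _ _ F (φ ((polyMatrix S P τ).adjugate * a • 1))) ?_
    rw [← compRingEquiv_apply, ← compRingEquiv_apply, ← map_mul, hφ, map_one]
  have hrank := rank_of_isUnit _ hunit
  rw [Fintype.card_prod, Fintype.card_fin, Fintype.card_fin] at hrank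
  rw [← hrank]
  exact (rank_submatrix _ (Equiv.refl _)
    ((B.orderIsoOfFin hB).toEquiv.prodCongr (Equiv.refl (Fin z)))).symm

/-! ### Girth -/

theorem tannerGraph_parityCheck_le {F : Type*} [Field F] {γ κ z : ℕ}
    {S₀ : Matrix (Fin γ) (Fin κ) F} (h₀ : ∀ i j, S₀ i j ≠ 0) (S : Matrix (Fin γ) (Fin κ) F)
    (P : Matrix (Fin γ) (Fin κ) (Fin z)) :
    tannerGraph (parityCheck S P) ≤ tannerGraph (parityCheck S₀ P) := by
  have hsupp : ∀ r c, parityCheck S P r c ≠ 0 → parityCheck S₀ P r c ≠ 0 := fun r c h =>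
    mul_ne_zero (h₀ _ _) (right_ne_zero_of_mul h)
  intro u v huv
  rw [tannerGraph, SimpleGraph.fromRel_adj] at huv ⊢
  refine ⟨huv.1, huv.2.imp ?_ ?_⟩ <;>
  exact fun ⟨r, c, hu, hv, h⟩ => ⟨r, c, hu, hv, hsupp r c h⟩

theorem exists_isVandermonde {F : Type*} [Field F] [Fintype F] (γ : ℕ) {κ : ℕ}
    (hκ : κ ≤ Fintype.card F) : ∃ S : Matrix (Fin γ) (Fin κ) F, IsVandermonde S := by
  obtain ⟨α⟩ := Function.Embedding.nonempty_of_card_le (α := Fin κ) (β := F) (by simpa using hκ)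
  exact ⟨_, α, α.injective, rfl⟩

end QCLDPC

theorem theorem3 {F : Type*} [Field F] [Fintype F] {γ κ z : ℕ}
    (hz : z.Prime) (hodd : Odd z)
    (hirr : Irreducible (∑ i ∈ Finset.range z, (Polynomial.X : Polynomial F) ^ i))
    (hγ : γ.factorial < z) (hκ : κ ≤ Fintype.card F)
    (S₀ : Matrix (Fin γ) (Fin κ) F) (P : Matrix (Fin γ) (Fin κ) (Fin z))
    (hgirth : ((2 * γ + 2 : ℕ) : ℕ∞) ≤
      (QCLDPC.tannerGraph (QCLDPC.parityCheck S₀ P)).egirth) :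
    (∀ S : Matrix (Fin γ) (Fin κ) F, QCLDPC.GcdCondition S P ↔ QCLDPC.IsMDS S) ∧
    (∀ S : Matrix (Fin γ) (Fin κ) F, QCLDPC.IsVandermonde S →
      QCLDPC.IsMDS S ∧ QCLDPC.IsBlockMDS S P ∧
      ((∀ i j, S₀ i j ≠ 0) → ((2 * γ + 2 : ℕ) : ℕ∞) ≤
        (QCLDPC.tannerGraph (QCLDPC.parityCheck S P)).egirth)) ∧
    (∃ S : Matrix (Fin γ) (Fin κ) F, QCLDPC.IsVandermonde S ∧ QCLDPC.IsBlockMDS S P) := by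
  have : NeZero z := ⟨hz.ne_zero⟩
  have hgcd := fun S => QCLDPC.gcdCondition_iff_isMDS hz.pos hirr hγ S P
  have hblock : ∀ S, QCLDPC.IsVandermonde S → QCLDPC.IsBlockMDS S P := fun S hS =>
    QCLDPC.isBlockMDS_of_gcdCondition ((hgcd S).2 hS.isMDS)
  refine ⟨hgcd, fun S hS => ⟨hS.isMDS, hblock S hS, fun h₀ => hgirth.trans
    (SimpleGraph.egirth_anti (QCLDPC.tannerGraph_parityCheck_le h₀ S P))⟩, ?_⟩
  obtain ⟨S, hS⟩ := QCLDPC.exists_isVandermonde (F := F) γ hκ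
  exact ⟨S, hS, hblock S hS⟩
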